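/- Fix a dimension $d\ge 1$, a fractional order $s\in(0,1)$ and $R>0$. For $N\ge 1$ put $h_{FD}=R/N$ and let $\mathcal T_{FD}$ be the uniform grid of nodes $x_k^{FD}=h_{FD}\,k$, $k\in\{-N,\dots,N\}^d$, on $[-R,R]^d$. Let $A_{FD}$ be the $(2N+1)^d\times(2N+1)^d$ matrix with entries $(A_{FD})_{j,m}=T_{j-m}$, where $$T_p=\frac1{(2\pi)^d}\int_{[-\pi,\pi]^d}\Big(\sum_{i=1}^d4\sin^2\tfrac{\xi_i}{2}\Big)^{s}e^{\mathrm i\,p\cdot\xi}\,d\xi ,\qquad p\in\mathbb Z^d .$$ Let $\mathcal T_h$ be a finite nonempty conforming mesh of nondegenerate $d$-simplices (the elements) contained in $(-R,R)^d$, with vertices $x_1,\dots,x_{N_v}$ and associated piecewise linear Lagrange basis functions $\phi_1,\dots,\phi_{N_v}$, extended by $0$ off the mesh. Let $h$ be the maximum diameter of the elements; let $a_h$ be the minimum height of the elements, where the heights of a simplex are the distances from its vertices to the hyperplanes through the remaining vertices. Let $N_{val}$ be the maximum number of elements sharing a vertex and $N_{FD}^h$ the maximum number of nodes of $\mathcal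 T_{FD}$ in a closed element. Let $I_h^{FD}$ be the transfer matrix $(I_h^{FD})_{k,j}=\phi_j(x_k^{FD})$ and $D_h$ the diagonal matrix of its column sums. For a set $\Omega\subset\mathbb R^d$ (such as the bounded domain that the mesh fits exactly or approximately) and a function $f$, let $\vec f_{FD}$ have the entries $f(x_k^{FD})$ for $x_k^{FD}\in\Omega$ and $0$ for $x_k^{FD}\notin\Omega$. The GoFD system is $$\frac1{h_{FD}^{2s}}\,D_h^{-1}(I_h^{FD})^TA_{FD}I_h^{FD}\,\vec u_h=D_h^{-1}(I_h^{FD})^T\vec f_{FD}.\qquad(*)$$ It is read either as the full system of $N_v$ equations for $\vec u_h\in\mathbb R^{N_v}$, or with the Dirichlet condition imposed at the vertices, i.e. $u_j=0$ for $x_j\notin\Omega$ together with the equations of $(*)$ that belong to the vertices $x_j\in\Omega$. There is a constant $C>0$ depending only on $d$, $s$ and $R$ (and not on $N$, the mesh, $\Omega$ or $f$) such that, whenever $$h_{FD}\le\frac{a_h}{(d+1)\sqrt d},$$ the system $(*)$ has, in either reading, exactly one solution $\vec u_h$, and this solution satisfies $$\vec u_h^T\vec u_h\le C\,N_{val}\,N_{FD}^h\Big(\frac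 h{a_h}\Big)^{4d}\,\vec f_{FD}^T\vec f_{FD}.$$ -/

import Mathlib

namespace GoFD

noncomputable section

/-- Euclidean space `ℝᵈ`. -/
abbrev Pt (d : ℕ) : Type := EuclideanSpace ℝ (Fin d)

/-! ### The uniform-grid finite difference matrix -/

/-- `ψ(ξ) = (∑ᵢ 4 sin²(ξᵢ/2))ˢ`, the symbol of the discrete fractional Laplacian. -/
def symbol (d : ℕ) (s : ℝ) (ξ : Fin d → ℝ) : ℝ :=
  (∑ i, 4 * Real.sin (ξ i / 2) ^ 2) ^ s

/-- `T_p = (2π)⁻ᵈ ∫_{[-π,π]ᵈ} ψ(ξ) exp(i p·ξ) dξ`, the Fourier coefficients of `ψ`. -/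
def symbolCoeff (d : ℕ) (s : ℝ) (p : Fin d → ℤ) : ℂ :=
  (1 / (2 * Real.pi) ^ d : ℝ) *
    ∫ ξ in Set.Icc (fun _ : Fin d => -Real.pi) (fun _ : Fin d => Real.pi),
      (symbol d s ξ : ℂ) * Complex.exp (Complex.I * ((∑ i, (p i : ℝ) * ξ i : ℝ) : ℂ))

/-- The coefficients `T_p` are real numbers. -/
theorem ofReal_re_symbolCoeff (d : ℕ) (s : ℝ) (p : Fin d → ℤ) :
    (((symbolCoeff d s p).re : ℝ) : ℂ) = symbolCoeff d s p := by
  rw [← Complex.conj_eq_iff_re]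
  unfold symbolCoeff
  rw [map_mul, Complex.conj_ofReal, ← integral_conj]
  congr 1
  rw [← MeasureTheory.integral_indicator measurableSet_Icc,
    ← MeasureTheory.integral_indicator measurableSet_Icc,
    ← MeasureTheory.integral_neg_eq_self]
  congr 1
  funext ξ
  have hmem : (-ξ ∈ Set.Icc (fun _ : Fin d => -Real.pi) (fun _ : Fin d => Real.pi)) ↔
      (ξ ∈ Set.Icc (fun _ : Fin d => -Real.pi) (fun _ : Fin d => Real.pi)) := by
    simp only [Set.mem_Icc, Pi.le_def, Pi.neg_apply]
    constructor
    · rintro ⟨h1, h2⟩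
      exact ⟨fun i => by linarith [h2 i], fun i => by linarith [h1 i]⟩
    · rintro ⟨h1, h2⟩
      exact ⟨fun i => by linarith [h2 i], fun i => by linarith [h1 i]⟩
  by_cases h : ξ ∈ Set.Icc (fun _ : Fin d => -Real.pi) (fun _ : Fin d => Real.pi)
  · rw [Set.indicator_of_mem h, Set.indicator_of_mem (hmem.2 h), map_mul, Complex.conj_ofReal,
      ← Complex.exp_conj, map_mul, Complex.conj_I, Complex.conj_ofReal]
    have hs : symbol d s (-ξ) = symbol d s ξ := by
      simp [symbol, neg_div]
    rw [hs]
    simp [Finset.sum_neg_distrib]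
  · rw [Set.indicator_of_notMem h, Set.indicator_of_notMem (fun h' => h (hmem.1 h'))]

/-- Multi-indices `k` with `-N ≤ kᵢ ≤ N`, labelling the `(2N+1)ᵈ` nodes of the uniform grid. -/
abbrev GridIdx (d N : ℕ) : Type := Fin d → Finset.Icc (-(N : ℤ)) (N : ℤ)

/-- The grid spacing `h_FD = R / N`. -/
def spacing (R : ℝ) (N : ℕ) : ℝ := R / N

/-- The grid node `x_k = h_FD • k` of the uniform grid on `[-R,R]ᵈ`. -/
def gridPt {d : ℕ} (R : ℝ) {N : ℕ} (k : GridIdx d N) : Pt d :=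
  WithLp.toLp 2 fun i => ((k i : ℤ) : ℝ) * spacing R N

/-- The matrix `A_FD`, with entries `T_{j-m}`. -/
def gridMatrix (d : ℕ) (s : ℝ) (N : ℕ) : Matrix (GridIdx d N) (GridIdx d N) ℝ :=
  Matrix.of fun j m => (symbolCoeff d s fun i => (j i : ℤ) - (m i : ℤ)).re

/-! ### Simplicial meshes -/

/-- A (conforming) simplicial mesh in `ℝᵈ`: a finite nonempty geometric simplicial complex, each
of whose simplices is a face of a `d`-dimensional one. -/
structure Mesh (d : ℕ) extends Geometry.SimplicialComplex ℝ (Pt d) where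
  finite_faces : faces.Finite
  nonempty_faces : faces.Nonempty
  pure : ∀ s ∈ faces, ∃ K ∈ faces, s ⊆ K ∧ K.card = d + 1

namespace Mesh

variable {d : ℕ} (T : Mesh d)

/-- The elements of the mesh: its `d`-dimensional simplices, given by their vertices. -/
def elements : Finset (Finset (Pt d)) := {K ∈ T.finite_faces.toFinset | K.card = d + 1}

variable {T} in
theorem mem_elements {K : Finset (Pt d)} :
    K ∈ T.elements ↔ K ∈ T.faces ∧ K.card = d + 1 := by
  simp [elements]

theorem elements_nonempty : T.elements.Nonempty := by
  obtain ⟨s, hs⟩ := T.nonempty_faces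
  obtain ⟨K, hK, -, hc⟩ := T.pure s hs
  exact ⟨K, mem_elements.2 ⟨hK, hc⟩⟩

open Classical in
/-- The (finite) set of vertices of the mesh. -/
def nodes : Finset (Pt d) := T.elements.biUnion id

variable {T} in
theorem mem_nodes {v : Pt d} : v ∈ T.nodes ↔ ∃ K ∈ T.elements, v ∈ K := by
  simp [nodes]

/-- The vertices of the elements are all the vertices of the complex. -/
theorem coe_nodes : (T.nodes : Set (Pt d)) = T.vertices := by
  ext v
  rw [Finset.mem_coe, mem_nodes]
  constructor
  · rintro ⟨K, hK, hv⟩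
    exact T.down_closed (mem_elements.1 hK).1 (Finset.singleton_subset_iff.2 hv)
      (Finset.singleton_nonempty v)
  · intro hv
    obtain ⟨K, hK, hs, hc⟩ := T.pure {v} hv
    exact ⟨K, mem_elements.2 ⟨hK, hc⟩, Finset.singleton_subset_iff.1 hs⟩

/-- The vertices of an element, as an affine basis of `ℝᵈ`. -/
def elementBasis {K : Finset (Pt d)} (hK : K ∈ T.elements) : AffineBasis K ℝ (Pt d) where
  toFun := (↑)
  ind' := T.indep (mem_elements.1 hK).1
  tot' := by
    rw [(T.indep (mem_elements.1 hK).1).affineSpan_eq_top_iff_card_eq_finrank_add_one]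
    simp [(mem_elements.1 hK).2]

open Classical in
/-- The barycentric coordinate at the vertex `v` of a point with respect to the element `K`
(equal to `0` if `v` is not a vertex of `K`). -/
def baryCoord {K : Finset (Pt d)} (hK : K ∈ T.elements) (v x : Pt d) : ℝ :=
  if hv : v ∈ K then (T.elementBasis hK).coord ⟨v, hv⟩ x else 0

open Classical in
/-- The piecewise linear Lagrange basis function `φ_v`: on each closed element it is the
barycentric coordinate at `v`, and it vanishes off the mesh. It does not depend on the choice of
the element containing the point, see `hat_eq`. -/
def hat (v x : Pt d) : ℝ :=
  if h : ∃ K ∈ T.elements, x ∈ convexHull ℝ (K : Set (Pt d)) then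
    T.baryCoord h.choose_spec.1 v x else 0

/-- If `x` is a convex combination of some of the vertices of an element, then its barycentric
coordinates are the coefficients. -/
theorem baryCoord_eq {K : Finset (Pt d)} (hK : K ∈ T.elements) {L : Finset (Pt d)} (hL : L ⊆ K)
    (w : Pt d → ℝ) (hw : ∀ y, y ∉ L → w y = 0) (h1 : ∑ y ∈ L, w y = 1) (v : Pt d) :
    T.baryCoord hK v (∑ y ∈ L, w y • y) = w v := by
  classical
  have e1 : ∑ y ∈ K, w y = 1 := by
    rw [← h1]
    exact (Finset.sum_subset hL fun y _ hy => hw y hy).symm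
  have e2 : ∑ y ∈ L, w y • y = ∑ y ∈ K, w y • y :=
    Finset.sum_subset hL fun y _ hy => by simp [hw y hy]
  have e1' : ∑ y : K, w y = 1 := by rw [← e1, ← Finset.sum_coe_sort K]
  unfold baryCoord
  split_ifs with hv
  · have e3 : ∑ y ∈ K, w y • y =
        Finset.univ.affineCombination ℝ (T.elementBasis hK) (fun y : K => w y) := by
      rw [Finset.univ.affineCombination_eq_linear_combination _ _ e1', ← Finset.sum_coe_sort K]
      rfl
    rw [e2, e3, AffineBasis.coord_apply_combination_of_mem _ (Finset.mem_univ _) e1']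
  · exact (hw v fun h => hv (hL h)).symm

/-- On every closed element `K`, the function `φ_v` is the barycentric coordinate at `v`. -/
theorem hat_eq {K : Finset (Pt d)} (hK : K ∈ T.elements) (v : Pt d) {x : Pt d}
    (hx : x ∈ convexHull ℝ (K : Set (Pt d))) : T.hat v x = T.baryCoord hK v x := by
  classical
  have h : ∃ K ∈ T.elements, x ∈ convexHull ℝ (K : Set (Pt d)) := ⟨K, hK, hx⟩
  unfold hat
  rw [dif_pos h]
  have hx' := h.choose_spec.2
  have hK' := h.choose_spec.1
  have hI : x ∈ convexHull ℝ ((K ∩ h.choose : Finset (Pt d)) : Set (Pt d)) := by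
    rw [Finset.coe_inter]
    exact T.inter_subset_convexHull (mem_elements.1 hK).1 (mem_elements.1 hK').1 ⟨hx, hx'⟩
  obtain ⟨w, -, h1, h2⟩ := Finset.mem_convexHull'.1 hI
  have hz : ∀ y, y ∉ K ∩ h.choose → (if y ∈ K ∩ h.choose then w y else 0) = 0 :=
    fun y hy => if_neg hy
  have h1' : ∑ y ∈ K ∩ h.choose, (if y ∈ K ∩ h.choose then w y else 0) = 1 := by
    rw [← h1]
    exact Finset.sum_congr rfl fun y hy => if_pos hy
  have h2' : ∑ y ∈ K ∩ h.choose, (if y ∈ K ∩ h.choose then w y else 0) • y = x :=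
    (Finset.sum_congr rfl fun y hy => by rw [if_pos hy]).trans h2
  have a := T.baryCoord_eq hK Finset.inter_subset_left _ hz h1' v
  have b := T.baryCoord_eq hK' Finset.inter_subset_right _ hz h1' v
  rw [h2'] at a b
  rw [a, b]

open Classical in
/-- The height (altitude) of the simplex `K` at its vertex `v`: the distance from `v` to the
hyperplane through the other vertices. -/
def height (K : Finset (Pt d)) (v : Pt d) : ℝ :=
  Metric.infDist v (affineSpan ℝ ((K.erase v : Finset (Pt d)) : Set (Pt d)) : Set (Pt d))

/-- `a_h`, the minimum of the heights of the elements (an infimum over a finite set). -/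
def minHeight : ℝ := sInf {a | ∃ K ∈ T.elements, ∃ v ∈ K, a = height K v}

/-- `h`, the maximum of the diameters of the elements. -/
def maxDiam : ℝ :=
  T.elements.sup' T.elements_nonempty fun K => Metric.diam (convexHull ℝ (K : Set (Pt d)))

open Classical in
/-- `N_val`, the maximum number of elements sharing a vertex. -/
def valence : ℕ := T.nodes.sup fun v => {K ∈ T.elements | v ∈ K}.card

open Classical in
/-- `N_FD^h`, the maximum number of grid nodes in a closed element. -/
def maxGridNodes (R : ℝ) (N : ℕ) : ℕ :=
  T.elements.sup fun K =>
    (Finset.univ.filter fun k : GridIdx d N => gridPt R k ∈ convexHull ℝ (K : Set (Pt d))).card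

/-! ### The GoFD system -/

/-- The transfer matrix `I_h^FD`, with entries `φ_v(x_k)`. -/
def transfer (R : ℝ) (N : ℕ) : Matrix (GridIdx d N) T.nodes ℝ :=
  Matrix.of fun k v => T.hat v (gridPt R k)

open Classical in
/-- The diagonal matrix `D_h` of the column sums of `I_h^FD`. -/
def colSum (R : ℝ) (N : ℕ) : Matrix T.nodes T.nodes ℝ :=
  Matrix.diagonal fun v => ∑ k, T.transfer R N k v

open Classical Matrix in
/-- `A_h = D_h⁻¹ (I_h^FD)ᵀ A_FD I_h^FD`. -/
def stiffness (s R : ℝ) (N : ℕ) : Matrix T.nodes T.nodes ℝ :=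
  (T.colSum R N)⁻¹ * (T.transfer R N)ᵀ * gridMatrix d s N * T.transfer R N

end Mesh

open Classical in
/-- The grid vector `f_FD` of a function `f` on `Ω`: its values at the grid nodes in `Ω`, and `0` at
the other grid nodes. -/
def gridVec {d : ℕ} (Ω : Set (Pt d)) (f : Pt d → ℝ) (R : ℝ) (N : ℕ) : GridIdx d N → ℝ :=
  fun k => if gridPt R k ∈ Ω then f (gridPt R k) else 0

namespace Mesh

variable {d : ℕ} (T : Mesh d)

open Classical Matrix in
/-- The vector `h_FD^{-2s} A_h u - D_h⁻¹ (I_h^FD)ᵀ F`, the residual of the GoFD system at `u`. -/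
def residual (s R : ℝ) (N : ℕ) (F : GridIdx d N → ℝ) (u : T.nodes → ℝ) : T.nodes → ℝ :=
  (1 / spacing R N ^ (2 * s)) • (T.stiffness s R N *ᵥ u) -
    ((T.colSum R N)⁻¹ * (T.transfer R N)ᵀ) *ᵥ F

/-- `u` solves the GoFD system, with one unknown and one equation for every mesh vertex. -/
def IsSolution (s R : ℝ) (N : ℕ) (F : GridIdx d N → ℝ) (u : T.nodes → ℝ) : Prop :=
  T.residual s R N F u = 0

/-- `u` solves the block of the GoFD system that belongs to the vertices in `Ω`, the unknowns at the
vertices outside `Ω` being set to `0`. -/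
def IsDirichletSolution (Ω : Set (Pt d)) (s R : ℝ) (N : ℕ) (F : GridIdx d N → ℝ)
    (u : T.nodes → ℝ) : Prop :=
  (∀ v : T.nodes, (v : Pt d) ∉ Ω → u v = 0) ∧
    ∀ v : T.nodes, (v : Pt d) ∈ Ω → T.residual s R N F u v = 0

end Mesh

end

end GoFD

/-! The estimate combines coercivity of the scaled matrix `h_FD^(-2s) A_FD`, with a constant
independent of `N`, and quantitative injectivity of the transfer matrix.

Coercivity (`gridMatrix_coercive`). The quadratic form of `A_FD` is the mean over `[-π,π]ᵈ` of the
symbol times `|trigSum y|²`. The symbol is small only near the origin, and a trigonometric sum with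
`(2N+1)ᵈ` frequencies cannot concentrate there: by Cauchy-Schwarz, a cube of side `π/(3N)` carries
at most half of the total mass given by Parseval. Outside that cube the symbol is at least
`(9N²)^(-s)`. Since `N h_FD = R`, scaling turns this into a constant depending on `s` and `R` only.

Injectivity (`dotProduct_self_le`). An element contains a ball of radius `a_h/(d+1)`, hence a cube
with half-side at least `h_FD`, hence a grid node and one further node along each axis, at a
distance comparable to `a_h`. Values of an affine function at these nodes determine it, and
extrapolation to a vertex costs a factor of order `h/a_h`. Summing squares over vertices costs the
valence.

Testing the system with `u` gives `c |y|² ≤ y·F` for `y = I_h u`, so `c² |y|² ≤ |F|²`, and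
injectivity passes from `y` to `u`. The same definiteness gives unique solvability. This proves the
bound with `(h/a_h)²` and without the grid node factor; the stated one is weaker. -/

namespace GoFD

/-! ### Fourier analysis: the quadratic form of `A_FD` and its coercivity -/

open MeasureTheory

/-- The box `[-π,π]ᵈ`. -/
def piBox (d : ℕ) : Set (Fin d → ℝ) :=
  Set.Icc (fun _ : Fin d => -Real.pi) (fun _ : Fin d => Real.pi)

/-- The Fourier series with coefficients `y`. -/
noncomputable def trigSum {d N : ℕ} (y : GridIdx d N → ℝ) (ξ : Fin d → ℝ) : ℂ :=
  ∑ k, (y k : ℂ) * Complex.exp (Complex.I * ((∑ i, ((k i : ℤ) : ℝ) * ξ i : ℝ) : ℂ))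

theorem continuous_symbol (d : ℕ) {s : ℝ} (hs : 0 ≤ s) : Continuous (symbol d s) := by
  unfold symbol
  refine Continuous.rpow_const (by fun_prop) fun _ => Or.inr hs

theorem continuous_trigSum {d N : ℕ} (y : GridIdx d N → ℝ) : Continuous (trigSum y) := by
  unfold trigSum
  fun_prop

theorem integrableOn_piBox {d : ℕ} {E : Type*} [NormedAddCommGroup E] {g : (Fin d → ℝ) → E}
    (hg : Continuous g) : IntegrableOn g (piBox d) :=
  hg.continuousOn.integrableOn_compact isCompact_Icc

theorem normSq_trigSum {d N : ℕ} (y : GridIdx d N → ℝ) (ξ : Fin d → ℝ) :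
    ((Complex.normSq (trigSum y ξ) : ℝ) : ℂ) = ∑ j, ∑ m, (y j : ℂ) * (y m : ℂ) *
      Complex.exp (Complex.I *
        ((∑ i, (((j i : ℤ) - (m i : ℤ) : ℤ) : ℝ) * ξ i : ℝ) : ℂ)) := by
  rw [Complex.normSq_eq_conj_mul_self, mul_comm]
  unfold trigSum
  rw [map_sum, Finset.sum_mul_sum]
  refine Finset.sum_congr rfl fun j _ => Finset.sum_congr rfl fun m _ => ?_
  rw [map_mul, Complex.conj_ofReal, ← Complex.exp_conj, map_mul, Complex.conj_I,
    Complex.conj_ofReal, mul_mul_mul_comm, ← Complex.exp_add]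
  congr 2
  push_cast
  simp only [sub_mul, Finset.sum_sub_distrib]
  ring

open Matrix in
theorem dotProduct_gridMatrix_mulVec {d N : ℕ} {s : ℝ} (hs : 0 ≤ s) (y : GridIdx d N → ℝ) :
    y ⬝ᵥ (gridMatrix d s N *ᵥ y) =
      1 / (2 * Real.pi) ^ d * ∫ ξ in piBox d, symbol d s ξ * Complex.normSq (trigSum y ξ) := by
  have hc : ∀ j m : GridIdx d N, Continuous fun ξ : Fin d → ℝ =>
      (symbol d s ξ : ℂ) * Complex.exp (Complex.I *
        ((∑ i, (((j i : ℤ) - (m i : ℤ) : ℤ) : ℝ) * ξ i : ℝ) : ℂ)) := fun j m =>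
    (Complex.continuous_ofReal.comp (continuous_symbol d hs)).mul (by fun_prop)
  have hc' : ∀ j m : GridIdx d N, IntegrableOn (fun ξ : Fin d → ℝ => ((y j : ℂ) * (y m : ℂ)) *
      ((symbol d s ξ : ℂ) * Complex.exp (Complex.I *
        ((∑ i, (((j i : ℤ) - (m i : ℤ) : ℤ) : ℝ) * ξ i : ℝ) : ℂ)))) (piBox d) := fun j m =>
    integrableOn_piBox ((hc j m).const_mul _)
  have key : ∀ ξ : Fin d → ℝ, ((symbol d s ξ * Complex.normSq (trigSum y ξ) : ℝ) : ℂ) =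
      ∑ j, ∑ m, ((y j : ℂ) * (y m : ℂ)) * ((symbol d s ξ : ℂ) * Complex.exp (Complex.I *
        ((∑ i, (((j i : ℤ) - (m i : ℤ) : ℤ) : ℝ) * ξ i : ℝ) : ℂ))) := fun ξ => by
    rw [Complex.ofReal_mul, normSq_trigSum, Finset.mul_sum]
    refine Finset.sum_congr rfl fun j _ => ?_
    rw [Finset.mul_sum]
    exact Finset.sum_congr rfl fun m _ => by ring
  apply Complex.ofReal_injective
  rw [Complex.ofReal_mul, ← integral_complex_ofReal]
  simp only [key]
  rw [integral_finsetSum _ fun j _ => integrable_finsetSum _ fun m _ => hc' j m, Finset.mul_sum]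
  unfold dotProduct
  rw [Complex.ofReal_sum]
  refine Finset.sum_congr rfl fun j _ => ?_
  rw [integral_finsetSum _ fun m _ => hc' j m, Finset.mul_sum, Matrix.mulVec]
  unfold dotProduct
  rw [Finset.mul_sum, Complex.ofReal_sum]
  refine Finset.sum_congr rfl fun m _ => ?_
  rw [integral_const_mul]
  simp only [gridMatrix, Matrix.of_apply, Complex.ofReal_mul, ofReal_re_symbolCoeff]
  unfold symbolCoeff piBox
  ring

theorem integral_Icc_exp_int (p : ℤ) :
    ∫ x in Set.Icc (-Real.pi) Real.pi, Complex.exp (Complex.I * ((p * x : ℝ) : ℂ)) =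
      if p = 0 then 2 * (Real.pi : ℂ) else 0 := by
  rw [integral_Icc_eq_integral_Ioc,
    ← intervalIntegral.integral_of_le (by linarith [Real.pi_pos])]
  split_ifs with h
  · subst h
    simp [two_mul]
  · have hp : Complex.I * (p : ℂ) ≠ 0 := by simp [h]
    have h1 := integral_exp_mul_complex (a := -Real.pi) (b := Real.pi) hp
    have h2 : ∀ x : ℝ, Complex.I * ((p * x : ℝ) : ℂ) = Complex.I * p * x := fun x => by
      push_cast; ring
    simp only [h2]
    rw [h1, div_eq_zero_iff, sub_eq_zero]
    left
    rw [Complex.exp_eq_exp_iff_exists_int]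
    exact ⟨p, by push_cast; ring⟩

/-- For exponent `0` the integrand is a product of one-variable exponentials. This makes `gridMatrix
d 0 N` the identity, so that Parseval becomes a case of `dotProduct_gridMatrix_mulVec`. -/
theorem symbolCoeff_zero (d : ℕ) (p : Fin d → ℤ) :
    symbolCoeff d 0 p = if p = 0 then 1 else 0 := by
  have h1 : (volume : Measure (Fin d → ℝ)).restrict (piBox d) =
      Measure.pi fun _ => (volume : Measure ℝ).restrict (Set.Icc (-Real.pi) Real.pi) := by
    rw [piBox, ← Set.pi_univ_Icc, volume_pi, Measure.restrict_pi_pi]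
  have h2 : ∀ ξ : Fin d → ℝ, (symbol d 0 ξ : ℂ) *
      Complex.exp (Complex.I * ((∑ i, (p i : ℝ) * ξ i : ℝ) : ℂ)) =
      ∏ i, Complex.exp (Complex.I * ((p i * ξ i : ℝ) : ℂ)) := fun ξ => by
    rw [← Complex.exp_sum, ← Finset.mul_sum]
    simp [symbol]
  unfold symbolCoeff
  rw [← piBox, h1]
  simp only [h2]
  rw [integral_fintype_prod_eq_prod (𝕜 := ℂ)
    (f := fun i x => Complex.exp (Complex.I * ((p i * x : ℝ) : ℂ)))]
  simp only [integral_Icc_exp_int]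
  split_ifs with h
  · subst h
    have hp : (Real.pi : ℂ) ≠ 0 := by exact_mod_cast Real.pi_ne_zero
    simp only [Pi.zero_apply, if_true, Finset.prod_const, Finset.card_univ, Fintype.card_fin]
    push_cast
    exact one_div_mul_cancel (pow_ne_zero _ (mul_ne_zero two_ne_zero hp))
  · obtain ⟨i, hi⟩ := Function.ne_iff.1 h
    rw [Finset.prod_eq_zero (Finset.mem_univ i) (by simpa using hi), mul_zero]

open Matrix in
/-- Parseval's identity. -/
theorem integral_normSq_trigSum {d N : ℕ} (y : GridIdx d N → ℝ) :
    1 / (2 * Real.pi) ^ d * ∫ ξ in piBox d, Complex.normSq (trigSum y ξ) = y ⬝ᵥ y := by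
  have h := dotProduct_gridMatrix_mulVec (s := 0) le_rfl y
  have h1 : gridMatrix d 0 N = 1 := by
    ext j m
    have : (fun i => (j i : ℤ) - (m i : ℤ)) = 0 ↔ j = m := by
      constructor
      · exact fun h => funext fun i => Subtype.ext (sub_eq_zero.1 (congrFun h i))
      · rintro rfl
        exact funext fun i => sub_self _
    simp only [gridMatrix, Matrix.of_apply, symbolCoeff_zero, this, Matrix.one_apply]
    split_ifs <;> simp
  -- This includes `ξ = 0`, since `0 ^ 0 = 1` for real powers.
  have h2 : ∀ ξ, symbol d 0 ξ = 1 := fun ξ => by simp [symbol]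
  simp only [h1, h2, one_mul, one_mulVec] at h
  exact h.symm

theorem card_gridIdx (d N : ℕ) : Fintype.card (GridIdx d N) = (2 * N + 1) ^ d := by
  simp only [Fintype.card_pi, Fintype.card_coe, Int.card_Icc, Finset.prod_const, Finset.card_univ,
    Fintype.card_fin]
  congr 1
  omega

/-- Cauchy-Schwarz over the frequencies. It limits the mass that can sit near `ξ = 0`. -/
theorem normSq_trigSum_le {d N : ℕ} (y : GridIdx d N → ℝ) (ξ : Fin d → ℝ) :
    Complex.normSq (trigSum y ξ) ≤ (2 * N + 1) ^ d * (y ⬝ᵥ y) := by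
  have h1 : ‖trigSum y ξ‖ ≤ ∑ k, |y k| := by
    refine (norm_sum_le _ _).trans (Finset.sum_le_sum fun k _ => ?_)
    rw [norm_mul, mul_comm Complex.I, Complex.norm_exp_ofReal_mul_I, mul_one, Complex.norm_real,
      Real.norm_eq_abs]
  have h2 := sq_sum_le_card_mul_sum_sq (s := Finset.univ) (f := fun k => |y k|)
  rw [Complex.normSq_eq_norm_sq]
  calc ‖trigSum y ξ‖ ^ 2 ≤ (∑ k, |y k|) ^ 2 := by gcongr
    _ ≤ _ := h2
    _ = _ := by
      rw [Finset.card_univ, card_gridIdx]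
      simp [dotProduct, sq]

/-- One coordinate away from zero suffices, by Jordan's inequality `|sin x| ≥ (2/π)|x|` on `[-π/2,
π/2]`. -/
theorem symbol_lower_bound {d N : ℕ} (hN : 1 ≤ N) {s : ℝ} (hs : 0 ≤ s) {ξ : Fin d → ℝ}
    (hξ : ξ ∈ piBox d) {i : Fin d} (hi : Real.pi / (6 * N) ≤ |ξ i|) :
    (1 / (9 * (N : ℝ) ^ 2)) ^ s ≤ symbol d s ξ := by
  have hN' : (0 : ℝ) < N := by exact_mod_cast hN
  have hp := Real.pi_pos
  refine Real.rpow_le_rpow (by positivity) ?_ hs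
  have hle : |ξ i / 2| ≤ Real.pi / 2 := by
    rw [abs_div, abs_two]
    have := abs_le.2 ⟨hξ.1 i, hξ.2 i⟩
    linarith
  have h1 := Real.mul_abs_le_abs_sin hle
  have h2 : 1 / (6 * (N : ℝ)) ≤ |Real.sin (ξ i / 2)| := by
    refine le_trans ?_ h1
    rw [abs_div, abs_two]
    have : 1 / (6 * (N : ℝ)) = 2 / Real.pi * ((Real.pi / (6 * N)) / 2) := by field_simp
    rw [this]
    gcongr
  calc 1 / (9 * (N : ℝ) ^ 2) = 4 * (1 / (6 * (N : ℝ))) ^ 2 := by field_simp; norm_num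
    _ ≤ 4 * |Real.sin (ξ i / 2)| ^ 2 := by gcongr
    _ = 4 * Real.sin (ξ i / 2) ^ 2 := by rw [sq_abs]
    _ ≤ _ := Finset.single_le_sum (f := fun i => 4 * Real.sin (ξ i / 2) ^ 2)
        (fun j _ => by positivity) (Finset.mem_univ i)

open Matrix in
/-- A lower bound for the smallest eigenvalue of `A_FD`. -/
theorem gridMatrix_coercive {d N : ℕ} (hd : 1 ≤ d) (hN : 1 ≤ N) {s : ℝ} (hs : 0 ≤ s)
    (y : GridIdx d N → ℝ) :
    1 / 2 * (1 / (9 * (N : ℝ) ^ 2)) ^ s * (y ⬝ᵥ y) ≤ y ⬝ᵥ (gridMatrix d s N *ᵥ y) := by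
  have hN' : (1 : ℝ) ≤ N := by exact_mod_cast hN
  have hp := Real.pi_pos
  set κ := (1 / (9 * (N : ℝ) ^ 2)) ^ s with hκ
  have hκ0 : 0 ≤ κ := by positivity
  have hy0 : 0 ≤ y ⬝ᵥ y := Finset.sum_nonneg fun i _ => mul_self_nonneg (y i)
  set B : ℝ := (2 * N + 1) ^ d * (y ⬝ᵥ y) with hB
  have hB0 : 0 ≤ B := by positivity
  -- The cube where the symbol may be small. Its half-side `π/(6N)` makes its share of the mass at
  -- most `((2N+1)/(6N))ᵈ ≤ 1/2`.
  set S : Set (Fin d → ℝ) :=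
    Set.Icc (fun _ => -(Real.pi / (6 * N))) (fun _ => Real.pi / (6 * N)) with hS
  have hvol : volume.real S = (Real.pi / (3 * N)) ^ d := by
    rw [measureReal_def, hS, Real.volume_Icc_pi, Finset.prod_const, Finset.card_univ,
      Fintype.card_fin, ENNReal.toReal_pow, ENNReal.toReal_ofReal]
    · congr 1; field_simp; norm_num
    · rw [sub_neg_eq_add]; positivity
  have hSsub : S ⊆ piBox d := by
    have : Real.pi / (6 * N) ≤ Real.pi := div_le_self hp.le (by linarith)
    exact Set.Icc_subset_Icc (fun _ => by simpa using this) (fun _ => this)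
  have hint1 : IntegrableOn (fun ξ => κ * Complex.normSq (trigSum y ξ)) (piBox d) :=
    integrableOn_piBox ((Complex.continuous_normSq.comp (continuous_trigSum y)).const_mul κ)
  have hint2 : IntegrableOn (S.indicator fun _ => κ * B) (piBox d) := by
    refine Integrable.indicator ?_ measurableSet_Icc
    exact integrableOn_piBox continuous_const
  -- Pointwise: on `S` the left integrand is at most `0`, and off `S` the symbol is at least `κ`.
  have hmono : ∫ ξ in piBox d, (κ * Complex.normSq (trigSum y ξ) -
      S.indicator (fun _ => κ * B) ξ) ≤
      ∫ ξ in piBox d, symbol d s ξ * Complex.normSq (trigSum y ξ) := by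
    refine setIntegral_mono_on (hint1.sub hint2) (integrableOn_piBox
      ((continuous_symbol d hs).mul (Complex.continuous_normSq.comp (continuous_trigSum y))))
      measurableSet_Icc fun ξ hξ => ?_
    by_cases h : ξ ∈ S
    · rw [Set.indicator_of_mem h]
      have h1 : κ * Complex.normSq (trigSum y ξ) ≤ κ * B := by
        gcongr; exact normSq_trigSum_le y ξ
      have h2 : 0 ≤ symbol d s ξ * Complex.normSq (trigSum y ξ) :=
        mul_nonneg (Real.rpow_nonneg (Finset.sum_nonneg fun i _ => by positivity) _)
          (Complex.normSq_nonneg _)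
      linarith
    · rw [Set.indicator_of_notMem h, sub_zero]
      have h1 : ∃ i, Real.pi / (6 * N) ≤ |ξ i| := by
        by_contra! hc
        exact h ⟨fun i => (abs_le.1 (hc i).le).1, fun i => (abs_le.1 (hc i).le).2⟩
      obtain ⟨i, hi⟩ := h1
      exact mul_le_mul_of_nonneg_right (symbol_lower_bound hN hs hξ hi) (Complex.normSq_nonneg _)
  rw [integral_sub hint1 hint2, integral_const_mul,
    setIntegral_indicator measurableSet_Icc, Set.inter_eq_self_of_subset_right hSsub,
    setIntegral_const, hvol, smul_eq_mul] at hmono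
  rw [dotProduct_gridMatrix_mulVec hs]
  have hsmall : 1 / (2 * Real.pi) ^ d * ((Real.pi / (3 * N)) ^ d * (κ * B)) ≤
      1 / 2 * κ * (y ⬝ᵥ y) := by
    have e : 1 / (2 * Real.pi) ^ d * ((Real.pi / (3 * N)) ^ d * (κ * B)) =
        ((2 * N + 1) / (6 * N)) ^ d * κ * (y ⬝ᵥ y) := by
      rw [hB]
      simp only [div_pow, mul_pow, show (6 : ℝ) = 2 * 3 by norm_num]
      field_simp
    rw [e]
    have h1 : (2 * (N : ℝ) + 1) / (6 * N) ≤ 1 / 2 := by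
      rw [div_le_div_iff₀ (by positivity) two_pos]; linarith
    have h2 : ((2 * (N : ℝ) + 1) / (6 * N)) ^ d ≤ 1 / 2 := by
      refine (pow_le_of_le_one (by positivity) (by linarith) (by omega)).trans h1
    gcongr
  have hpars := integral_normSq_trigSum y
  calc 1 / 2 * κ * (y ⬝ᵥ y) = κ * (y ⬝ᵥ y) - 1 / 2 * κ * (y ⬝ᵥ y) := by ring
    _ ≤ κ * (y ⬝ᵥ y) - 1 / (2 * Real.pi) ^ d * ((Real.pi / (3 * N)) ^ d * (κ * B)) := by linarith
    _ = 1 / (2 * Real.pi) ^ d * (κ * (∫ ξ in piBox d, Complex.normSq (trigSum y ξ)) -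
        (Real.pi / (3 * N)) ^ d * (κ * B)) := by rw [← hpars]; ring
    _ ≤ _ := by gcongr

end GoFD

/-! ### Simplex geometry: grid nodes inside elements and control of vertex values -/

namespace GoFD

/-- A barycentric coordinate has slope at most one over the height: if it changes by `t ≠ 0` along
`y`, then `b i - t⁻¹ • y` lies on the opposite hyperplane, so the height is at most `‖y‖ / |t|`. -/
theorem abs_coord_linear_mul_infDist_le {ι V : Type*} [Fintype ι] [NormedAddCommGroup V]
    [NormedSpace ℝ V] (b : AffineBasis ι ℝ V) (i : ι) (y : V) :
    |(b.coord i).linear y| * Metric.infDist (b i) (affineSpan ℝ (b '' {i}ᶜ)) ≤ ‖y‖ := by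
  set t := (b.coord i).linear y with ht
  rcases eq_or_ne t 0 with h | h
  · rw [h]; simp
  · have h1 : b i - t⁻¹ • y ∈ affineSpan ℝ (b '' {i}ᶜ) := by
      have hx : b.coord i (b i - t⁻¹ • y) = 0 := by
        have := (b.coord i).map_vadd (b i) (-(t⁻¹ • y))
        rw [vadd_eq_add, vadd_eq_add, neg_add_eq_sub, map_neg, map_smul, ← ht, b.coord_apply_eq,
          smul_eq_mul, inv_mul_cancel₀ h] at this
        rw [this]; simp
      rw [← b.affineCombination_coord_eq_self (b i - t⁻¹ • y)]
      refine affineCombination_mem_affineSpan_image (b.sum_coord_apply_eq_one _)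
        (fun j _ hj => ?_) _
      rw [Set.mem_compl_iff, not_not, Set.mem_singleton_iff] at hj
      rw [hj, hx]
    have h2 := Metric.infDist_le_dist_of_mem (x := b i) h1
    rw [dist_eq_norm, sub_sub_cancel, norm_smul, norm_inv, Real.norm_eq_abs] at h2
    calc |t| * _ ≤ |t| * (|t|⁻¹ * ‖y‖) := by gcongr
      _ = ‖y‖ := by field_simp

/-- An affine function on `ℝᵈ` is bounded in terms of its values at the corners `x₀`,
`x₀ + t eᵢ`. -/
theorem abs_affineMap_le {d : ℕ} (p : Pt d →ᵃ[ℝ] ℝ) {x₀ : Pt d} {t V : ℝ} (ht : 0 < t)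
    (h0 : |p x₀| ≤ V) (h1 : ∀ i, |p (x₀ + EuclideanSpace.single i t)| ≤ V) (x : Pt d) :
    |p x| ≤ V + d * (‖x - x₀‖ * (2 * V / t)) := by
  have hV : 0 ≤ V := (abs_nonneg _).trans h0
  have hg : ∀ i, |p.linear (EuclideanSpace.single i 1)| ≤ 2 * V / t := fun i => by
    have h2 := p.map_vadd x₀ (EuclideanSpace.single i t)
    rw [vadd_eq_add, vadd_eq_add, add_comm _ x₀] at h2
    have h3 : (EuclideanSpace.single i t : Pt d) = t • EuclideanSpace.single i (1 : ℝ) := by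
      ext j; simp
    rw [h3, map_smul, smul_eq_mul, ← h3] at h2
    rw [le_div_iff₀ ht]
    have h4 : p.linear (EuclideanSpace.single i 1) * t =
        p (x₀ + EuclideanSpace.single i t) - p x₀ := by linarith
    have h5 : |p.linear (EuclideanSpace.single i 1)| * t =
        |p.linear (EuclideanSpace.single i 1) * t| := by rw [abs_mul, abs_of_pos ht]
    rw [h5, h4]
    linarith [abs_sub (p (x₀ + EuclideanSpace.single i t)) (p x₀), h1 i]
  have hx : p x = p x₀ + ∑ i, (x - x₀) i * p.linear (EuclideanSpace.single i 1) := by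
    have h2 := p.map_vadd x₀ (x - x₀)
    rw [vadd_eq_add, vadd_eq_add, sub_add_cancel] at h2
    have h3 : x - x₀ = ∑ i, (x - x₀) i • (EuclideanSpace.single i 1 : Pt d) := by
      ext j
      simp [Finset.sum_apply, Pi.single_apply]
    rw [h2, add_comm]
    congr 1
    conv_lhs => rw [h3]
    rw [map_sum]
    exact Finset.sum_congr rfl fun i _ => by rw [map_smul, smul_eq_mul]
  rw [hx]
  refine (abs_add_le _ _).trans (add_le_add h0 ?_)
  refine (Finset.abs_sum_le_sum_abs _ _).trans ?_
  calc ∑ i, |(x - x₀) i * p.linear (EuclideanSpace.single i 1)|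
      ≤ ∑ _i : Fin d, ‖x - x₀‖ * (2 * V / t) := Finset.sum_le_sum fun i _ => by
        rw [abs_mul]
        exact mul_le_mul (PiLp.norm_apply_le (x - x₀) i) (hg i) (abs_nonneg _) (norm_nonneg _)
    _ = _ := by simp

namespace Mesh

variable {d : ℕ} (T : Mesh d)

theorem minHeight_le_height {K : Finset (Pt d)} (hK : K ∈ T.elements) {v : Pt d} (hv : v ∈ K) :
    T.minHeight ≤ height K v :=
  csInf_le ⟨0, by rintro _ ⟨K, -, v, -, rfl⟩; exact Metric.infDist_nonneg⟩ ⟨K, hK, v, hv, rfl⟩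

theorem mem_space_of_mem_convexHull {K : Finset (Pt d)} (hK : K ∈ T.elements) {x : Pt d}
    (hx : x ∈ convexHull ℝ (K : Set (Pt d))) : x ∈ T.space :=
  Set.mem_iUnion₂.2 ⟨K, (mem_elements.1 hK).1, hx⟩

theorem norm_sub_le_maxDiam {K : Finset (Pt d)} (hK : K ∈ T.elements) {x y : Pt d}
    (hx : x ∈ convexHull ℝ (K : Set (Pt d))) (hy : y ∈ convexHull ℝ (K : Set (Pt d))) :
    ‖x - y‖ ≤ T.maxDiam := by
  rw [← dist_eq_norm]
  have hbdd := (K.finite_toSet.isCompact_convexHull (𝕜 := ℝ)).isBounded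
  refine (Metric.dist_le_diam_of_mem hbdd hx hy).trans ?_
  exact Finset.le_sup' (fun K : Finset (Pt d) => Metric.diam (convexHull ℝ (K : Set (Pt d)))) hK

theorem minHeight_le_maxDiam (hd : 1 ≤ d) : T.minHeight ≤ T.maxDiam := by
  classical
  obtain ⟨K, hK⟩ := T.elements_nonempty
  have hc := (mem_elements.1 hK).2
  obtain ⟨v, hv, w, hw, hne⟩ := Finset.one_lt_card.1 (by omega : 1 < K.card)
  refine (T.minHeight_le_height hK hv).trans ?_
  refine (Metric.infDist_le_dist_of_mem (subset_affineSpan ℝ _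
    (Finset.mem_coe.2 (Finset.mem_erase.2 ⟨hne.symm, hw⟩)))).trans ?_
  rw [dist_eq_norm]
  exact T.norm_sub_le_maxDiam hK (subset_convexHull ℝ _ hv) (subset_convexHull ℝ _ hw)

theorem abs_coord_sub_mul_minHeight_le {K : Finset (Pt d)} (hK : K ∈ T.elements) (v : K)
    (x y : Pt d) :
    |(T.elementBasis hK).coord v x - (T.elementBasis hK).coord v y| * T.minHeight ≤ ‖x - y‖ := by
  classical
  set b := T.elementBasis hK with hb
  have h1 := abs_coord_linear_mul_infDist_le b v (x - y)
  have h2 : b '' {v}ᶜ = ((K.erase v : Finset (Pt d)) : Set (Pt d)) := by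
    ext z
    simp only [Set.mem_image, Set.mem_compl_iff, Set.mem_singleton_iff, Finset.mem_coe,
      Finset.mem_erase]
    constructor
    · rintro ⟨w, hw, rfl⟩
      exact ⟨fun h => hw (Subtype.ext h), w.2⟩
    · rintro ⟨h, hz⟩
      exact ⟨⟨z, hz⟩, fun h' => h (congrArg Subtype.val h'), rfl⟩
  have h3 : (b.coord v).linear (x - y) = b.coord v x - b.coord v y := by
    rw [← vsub_eq_sub, AffineMap.linearMap_vsub, vsub_eq_sub]
  rw [h2, h3] at h1
  refine le_trans ?_ h1
  gcongr
  exact T.minHeight_le_height hK v.2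

theorem mem_convexHull_iff {K : Finset (Pt d)} (hK : K ∈ T.elements) {x : Pt d} :
    x ∈ convexHull ℝ (K : Set (Pt d)) ↔ ∀ v, 0 ≤ (T.elementBasis hK).coord v x := by
  have h := (T.elementBasis hK).convexHull_eq_nonneg_coord
  have h2 : Set.range (T.elementBasis hK) = (K : Set (Pt d)) := by
    ext z
    exact ⟨by rintro ⟨v, rfl⟩; exact v.2, fun hz => ⟨⟨z, hz⟩, rfl⟩⟩
  rw [h2] at h
  rw [h, Set.mem_ofPred_eq]

/-- An element contains a ball of radius `a_h / (d + 1)`. -/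
theorem exists_closedBall_subset_convexHull (ha : 0 < T.minHeight) {K : Finset (Pt d)}
    (hK : K ∈ T.elements) :
    ∃ c : Pt d, ∀ x, ‖x - c‖ ≤ T.minHeight / (d + 1) → x ∈ convexHull ℝ (K : Set (Pt d)) := by
  -- All barycentric coordinates of the centroid equal `1/(d+1)`, and each is `1/a_h`-Lipschitz.
  refine ⟨Finset.univ.centroid ℝ (T.elementBasis hK), fun x hx => ?_⟩
  rw [T.mem_convexHull_iff hK]
  intro v
  have h1 := T.abs_coord_sub_mul_minHeight_le hK v x
    (Finset.univ.centroid ℝ (T.elementBasis hK))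
  rw [(T.elementBasis hK).coord_apply_centroid (Finset.mem_univ v), Finset.card_univ,
    Fintype.card_coe, (mem_elements.1 hK).2] at h1
  push_cast at h1
  have h2 : |(T.elementBasis hK).coord v x - ((d : ℝ) + 1)⁻¹| ≤ ((d : ℝ) + 1)⁻¹ := by
    refine le_of_mul_le_mul_right (h1.trans (hx.trans_eq ?_)) ha
    rw [div_eq_inv_mul]
  linarith [(abs_le.1 h2).1]

/-- The mesh lies in `(-R,R)ᵈ` and `R = N h_FD`, so truncating the lattice to `|kᵢ| ≤ N` loses no
lattice point of the mesh. -/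
theorem exists_gridPt {R : ℝ} (hR : 0 < R) {N : ℕ} (hN : 1 ≤ N)
    (hT : ∀ x ∈ T.space, ∀ i, x i ∈ Set.Ioo (-R) R) {x : Pt d} (hx : x ∈ T.space) {z : Fin d → ℤ}
    (hz : ∀ i, x i = z i * spacing R N) : ∃ k : GridIdx d N, gridPt R k = x := by
  have hN' : (0 : ℝ) < N := by exact_mod_cast hN
  have hη : 0 < spacing R N := div_pos hR hN'
  have hRN : R = N * spacing R N := by unfold spacing; field_simp
  have hk : ∀ i, z i ∈ Finset.Icc (-(N : ℤ)) (N : ℤ) := fun i => by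
    obtain ⟨h1, h2⟩ := hT x hx i
    rw [hz] at h1 h2
    have h3 : (-(N : ℝ)) < z i := lt_of_mul_lt_mul_right (by linarith) hη.le
    have h4 : (z i : ℝ) < N := lt_of_mul_lt_mul_right (by linarith) hη.le
    rw [Finset.mem_Icc]
    exact ⟨by exact_mod_cast h3.le, by exact_mod_cast h4.le⟩
  refine ⟨fun i => ⟨z i, hk i⟩, ?_⟩
  ext i
  simp [gridPt, hz]

/-- An element contains the corners of a grid cube with edges comparable to `a_h`. -/
theorem exists_grid_corner (hd : 1 ≤ d) {R : ℝ} (hR : 0 < R) {N : ℕ} (hN : 1 ≤ N)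
    (hT : ∀ x ∈ T.space, ∀ i, x i ∈ Set.Ioo (-R) R)
    (hh : spacing R N ≤ T.minHeight / ((d + 1) * Real.sqrt d))
    {K : Finset (Pt d)} (hK : K ∈ T.elements) :
    ∃ (k₀ : GridIdx d N) (t : ℝ), T.minHeight / ((d + 1) * Real.sqrt d) ≤ 2 * t ∧
      gridPt R k₀ ∈ convexHull ℝ (K : Set (Pt d)) ∧
      ∀ i, ∃ k : GridIdx d N, gridPt R k ∈ convexHull ℝ (K : Set (Pt d)) ∧
        gridPt R k = gridPt R k₀ + EuclideanSpace.single i t := by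
  have hN' : (0 : ℝ) < N := by exact_mod_cast hN
  have hd' : (0 : ℝ) < d := by exact_mod_cast hd
  set η := spacing R N with hη_def
  have hη : 0 < η := div_pos hR hN'
  set τ := T.minHeight / ((d + 1) * Real.sqrt d) with hτ
  have hτ0 : 0 < τ := hη.trans_le hh
  have ha : 0 < T.minHeight := by
    have : 0 < (d + 1) * Real.sqrt d := by positivity
    exact (div_pos_iff_of_pos_right this).1 hτ0
  obtain ⟨c, hc⟩ := T.exists_closedBall_subset_convexHull ha hK
  -- The half-diagonal `√d τ` equals the radius `a_h/(d+1)`; this is the source of the threshold on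
  -- `h_FD`.
  have hcube : ∀ x : Pt d, (∀ i, |x i - c i| ≤ τ) → x ∈ convexHull ℝ (K : Set (Pt d)) := by
    intro x hx
    apply hc
    have h1 : ‖x - c‖ ^ 2 ≤ (Real.sqrt d * τ) ^ 2 := by
      rw [EuclideanSpace.norm_sq_eq, mul_pow, Real.sq_sqrt hd'.le]
      calc ∑ i, ‖(x - c) i‖ ^ 2 ≤ ∑ _i : Fin d, τ ^ 2 := Finset.sum_le_sum fun i _ => by
            rw [Real.norm_eq_abs]; exact pow_le_pow_left₀ (abs_nonneg _) (hx i) 2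
        _ = _ := by simp
    refine (pow_le_pow_iff_left₀ (norm_nonneg _) (by positivity) two_ne_zero).1 h1 |>.trans_eq ?_
    rw [hτ]
    have : Real.sqrt d ≠ 0 := (Real.sqrt_pos.2 hd').ne'
    field_simp
  -- The lowest lattice point of the cube, within `η` of its lower corner.
  set n : Fin d → ℤ := fun i => ⌈(c i - τ) / η⌉ with hn
  have hn1 : ∀ i, c i - τ ≤ n i * η := fun i => (div_le_iff₀ hη).1 (Int.le_ceil _)
  have hn2 : ∀ i, n i * η < c i - τ + η := fun i => by
    have := Int.ceil_lt_add_one ((c i - τ) / η)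
    have h2 := mul_lt_mul_of_pos_right this hη
    rwa [add_mul, div_mul_cancel₀ _ hη.ne', one_mul] at h2
  -- A shift by `mη ≤ τ` ends below `c i + η ≤ c i + τ`, inside the cube. Since `m ≥ 1`, also `2mη ≥
  -- (m+1)η > τ`.
  set m : ℤ := ⌊τ / η⌋ with hm
  have hm1 : m * η ≤ τ := (le_div_iff₀ hη).1 (Int.floor_le _)
  have hm2 : τ < (m + 1) * η := (div_lt_iff₀ hη).1 (Int.lt_floor_add_one _)
  have hm3 : (1 : ℝ) ≤ m := by
    have : (1 : ℤ) ≤ m := Int.le_floor.2 (by rw [Int.cast_one]; exact (one_le_div hη).2 hh)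
    exact_mod_cast this
  have hmη : η ≤ m * η := le_mul_of_one_le_left hη.le hm3
  set x₀ : Pt d := WithLp.toLp 2 fun i => (n i : ℝ) * η with hx₀
  have hx₀i : ∀ i, x₀ i = n i * η := fun i => rfl
  have hx₀K : x₀ ∈ convexHull ℝ (K : Set (Pt d)) := hcube _ fun i => by
    rw [hx₀i, abs_le]
    constructor <;> linarith [hn1 i, hn2 i]
  obtain ⟨k₀, hk₀⟩ := T.exists_gridPt hR hN hT (T.mem_space_of_mem_convexHull hK hx₀K) hx₀i
  refine ⟨k₀, m * η, by linarith, hk₀ ▸ hx₀K, fun i => ?_⟩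
  have hxi : ∀ j, (x₀ + EuclideanSpace.single i (m * η)) j =
      ((n j + if j = i then m else 0 : ℤ) : ℝ) * η := fun j => by
    rw [PiLp.add_apply, hx₀i, PiLp.single_apply]
    split_ifs <;> push_cast <;> ring
  have hxK : x₀ + EuclideanSpace.single i (m * η) ∈ convexHull ℝ (K : Set (Pt d)) :=
    hcube _ fun j => by
      rw [PiLp.add_apply, hx₀i, PiLp.single_apply, abs_le]
      split_ifs <;> constructor <;> linarith [hn1 j, hn2 j]
  obtain ⟨k, hk⟩ := T.exists_gridPt hR hN hT (T.mem_space_of_mem_convexHull hK hxK) hxi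
  exact ⟨k, hk ▸ hxK, by rw [hk, hk₀]⟩

theorem mem_nodes_of_mem {K : Finset (Pt d)} (hK : K ∈ T.elements) (v : K) :
    (v : Pt d) ∈ T.nodes := mem_nodes.2 ⟨K, hK, v.2⟩

open Matrix in
theorem transfer_mulVec_apply {R : ℝ} {N : ℕ} {K : Finset (Pt d)} (hK : K ∈ T.elements)
    {k : GridIdx d N} (hk : gridPt R k ∈ convexHull ℝ (K : Set (Pt d))) (u : T.nodes → ℝ) :
    (T.transfer R N *ᵥ u) k = ∑ v : K, (T.elementBasis hK).coord v (gridPt R k) *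
      u ⟨v, T.mem_nodes_of_mem hK v⟩ := by
  symm
  refine Fintype.sum_of_injective (fun v : K => (⟨v, T.mem_nodes_of_mem hK v⟩ : T.nodes))
    (fun v w h => Subtype.ext (congrArg (fun z : T.nodes => (z : Pt d)) h)) _ _ ?_ ?_
  · rintro ⟨w, hw⟩ h
    have hwK : w ∉ K := fun hw' => h ⟨⟨w, hw'⟩, rfl⟩
    simp [transfer, T.hat_eq hK _ hk, baryCoord, hwK]
  · intro v
    simp [transfer, T.hat_eq hK _ hk, baryCoord]

/-- The values of the interpolated function at the grid nodes of an element control its values at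
the vertices of the element. -/
theorem sq_apply_le_sum_grid (hd : 1 ≤ d) {R : ℝ} (hR : 0 < R) {N : ℕ} (hN : 1 ≤ N)
    (hT : ∀ x ∈ T.space, ∀ i, x i ∈ Set.Ioo (-R) R)
    (hh : spacing R N ≤ T.minHeight / ((d + 1) * Real.sqrt d)) (u : T.nodes → ℝ)
    {K : Finset (Pt d)} (hK : K ∈ T.elements) (v : K) {B : ℝ}
    (hB : ∀ k, gridPt R k ∈ convexHull ℝ (K : Set (Pt d)) →
      ((T.transfer R N).mulVec u k) ^ 2 ≤ B) :
    u ⟨v, T.mem_nodes_of_mem hK v⟩ ^ 2 ≤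
      ((1 + 4 * d * ((d + 1) * Real.sqrt d)) * (T.maxDiam / T.minHeight)) ^ 2 * B := by
  have hN' : (0 : ℝ) < N := by exact_mod_cast hN
  have hd' : (0 : ℝ) < d := by exact_mod_cast hd
  have hη : 0 < spacing R N := div_pos hR hN'
  have hD : 0 < (d + 1) * Real.sqrt d := by positivity
  set D := (d + 1) * Real.sqrt d with hD_def
  have ha : 0 < T.minHeight := (div_pos_iff_of_pos_right hD).1 (hη.trans_le hh)
  obtain ⟨k₀, t, ht, hk₀, hk⟩ := T.exists_grid_corner hd hR hN hT hh hK
  have ht0 : 0 < t := by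
    have := div_pos ha hD
    linarith
  set b := T.elementBasis hK with hb
  -- The interpolant on `K`, extended affinely to the whole space.
  set p : Pt d →ᵃ[ℝ] ℝ := (Fintype.linearCombination ℝ
    (fun w : K => u ⟨w, T.mem_nodes_of_mem hK w⟩)).toAffineMap.comp b.coords with hp
  have hpx : ∀ x, p x = ∑ w : K, b.coord w x * u ⟨w, T.mem_nodes_of_mem hK w⟩ := fun x => by
    simp [hp, Fintype.linearCombination_apply]
  have hB0 : 0 ≤ B := (sq_nonneg _).trans (hB k₀ hk₀)
  have hV : ∀ k : GridIdx d N, gridPt R k ∈ convexHull ℝ (K : Set (Pt d)) → |p (gridPt R k)| ≤ Real.sqrt B := by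
    intro k hk
    rw [hpx, ← T.transfer_mulVec_apply hK hk]
    exact Real.abs_le_sqrt (hB k hk)
  have h1 := abs_affineMap_le p ht0 (hV k₀ hk₀) (fun i => by
    obtain ⟨k, hk1, hk2⟩ := hk i
    rw [← hk2]
    exact hV k hk1) (v : Pt d)
  have h2 : p v = u ⟨v, T.mem_nodes_of_mem hK v⟩ := by
    rw [hpx, Finset.sum_eq_single v]
    · have : b.coord v (v : Pt d) = 1 := b.coord_apply_eq v
      rw [this, one_mul]
    · intro w _ hw
      have : b.coord w (v : Pt d) = 0 := b.coord_apply_ne hw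
      rw [this, zero_mul]
    · simp
  rw [h2] at h1
  have h3 : ‖(v : Pt d) - gridPt R k₀‖ ≤ T.maxDiam :=
    T.norm_sub_le_maxDiam hK (subset_convexHull ℝ _ v.2) hk₀
  have h4 : 1 ≤ T.maxDiam / T.minHeight := (one_le_div ha).2 (T.minHeight_le_maxDiam hd)
  have h5 : 1 / t ≤ 2 * D / T.minHeight := by
    rw [div_le_div_iff₀ ht0 ha]
    rw [div_le_iff₀ hD] at ht
    linarith
  -- The slope term is `d · h · 2√B / t` with `1/t ≤ 2D/a_h`, whence `4dD`; the summand `1` is the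
  -- value at the corner, enlarged by `h/a_h ≥ 1`.
  have h6 : |u ⟨v, T.mem_nodes_of_mem hK v⟩| ≤
      (1 + 4 * d * D) * (T.maxDiam / T.minHeight) * Real.sqrt B := by
    have h7 : ‖(v : Pt d) - gridPt R k₀‖ * (2 * Real.sqrt B / t) ≤
        T.maxDiam * (2 * Real.sqrt B * (2 * D / T.minHeight)) := by
      have : 2 * Real.sqrt B / t = 2 * Real.sqrt B * (1 / t) := by ring
      rw [this]
      have h0 : 0 ≤ T.maxDiam := (norm_nonneg _).trans h3
      gcongr
    have h8 : Real.sqrt B ≤ Real.sqrt B * (T.maxDiam / T.minHeight) :=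
      le_mul_of_one_le_right (Real.sqrt_nonneg _) h4
    calc _ ≤ _ := h1
      _ ≤ Real.sqrt B * (T.maxDiam / T.minHeight) +
          d * (T.maxDiam * (2 * Real.sqrt B * (2 * D / T.minHeight))) := by gcongr
      _ = _ := by ring
  calc u ⟨v, T.mem_nodes_of_mem hK v⟩ ^ 2 = |u ⟨v, T.mem_nodes_of_mem hK v⟩| ^ 2 := (sq_abs _).symm
    _ ≤ ((1 + 4 * d * D) * (T.maxDiam / T.minHeight) * Real.sqrt B) ^ 2 := by gcongr
    _ = _ := by rw [mul_pow, Real.sq_sqrt hB0]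

open Classical in
/-- A point of the mesh lies in at most `N_val` closed elements. -/
theorem card_elements_containing_le (x : Pt d) :
    (T.elements.filter fun K : Finset (Pt d) => x ∈ convexHull ℝ (K : Set (Pt d))).card ≤ T.valence := by
  rcases Finset.eq_empty_or_nonempty
    (T.elements.filter fun K : Finset (Pt d) => x ∈ convexHull ℝ (K : Set (Pt d))) with h | ⟨K₀, h⟩
  · rw [h]; simp
  · obtain ⟨hK₀, hx₀⟩ := Finset.mem_filter.1 h
    have h1 : ∃ v : K₀, (T.elementBasis hK₀).coord v x ≠ 0 := by
      by_contra! hc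
      have := (T.elementBasis hK₀).sum_coord_apply_eq_one x
      simp [hc] at this
    obtain ⟨v, hv⟩ := h1
    -- Conformity enters here: `hat` may be computed in any element containing `x`, so `v` is a
    -- vertex of all of them.
    have hhat : T.hat v x ≠ 0 := by
      rw [T.hat_eq hK₀ _ hx₀]
      simpa [baryCoord] using hv
    refine le_trans (Finset.card_le_card fun K hK => ?_) (Finset.le_sup
      (f := fun v => (T.elements.filter fun K => v ∈ K).card) (T.mem_nodes_of_mem hK₀ v))
    obtain ⟨hK, hx⟩ := Finset.mem_filter.1 hK
    refine Finset.mem_filter.2 ⟨hK, ?_⟩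
    by_contra hvK
    rw [T.hat_eq hK _ hx] at hhat
    simp [baryCoord, hvK] at hhat

end Mesh
end GoFD

/-! ### Injectivity of the transfer matrix and removal of `D_h` -/

namespace GoFD

open Matrix

/-- A linear system with a positive definite matrix, some unknowns of which are set to zero and
whose corresponding equations are dropped, has exactly one solution. -/
theorem existsUnique_constrained {ι : Type*} [Fintype ι] (M : Matrix ι ι ℝ)
    (hM : ∀ u, u ⬝ᵥ (M *ᵥ u) = 0 → u = 0) (S : ι → Prop) (b : ι → ℝ) :
    ∃! u : ι → ℝ, (∀ i, ¬ S i → u i = 0) ∧ ∀ i, S i → (M *ᵥ u) i = b i := by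
  classical
  -- Dropped rows become identity rows. If `L u = 0`, each `u i * (M *ᵥ u) i` has a zero factor, so
  -- definiteness gives `u = 0`; finite dimension gives surjectivity.
  let L : (ι → ℝ) →ₗ[ℝ] (ι → ℝ) :=
    { toFun := fun u i => if S i then (M *ᵥ u) i else u i
      map_add' := fun u w => by
        ext i; by_cases h : S i <;> simp [h, mulVec_add]
      map_smul' := fun c u => by
        ext i; by_cases h : S i <;> simp [h, mulVec_smul] }
  have hL : ∀ u i, L u i = if S i then (M *ᵥ u) i else u i := fun _ _ => rfl
  have hinj : Function.Injective L := by
    rw [injective_iff_map_eq_zero]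
    refine fun u hu => hM u (Finset.sum_eq_zero fun i _ => ?_)
    have hi : L u i = 0 := congrFun hu i
    rw [hL] at hi
    split_ifs at hi <;> simp [hi]
  have key : ∀ u, ((∀ i, ¬ S i → u i = 0) ∧ ∀ i, S i → (M *ᵥ u) i = b i) ↔
      L u = fun i => if S i then b i else 0 := by
    intro u
    rw [funext_iff]
    simp only [hL]
    constructor
    · rintro ⟨h0, h1⟩ i
      by_cases h : S i <;> simp [h, h0, h1]
    · intro h
      exact ⟨fun i hi => by simpa [hi] using h i, fun i hi => by simpa [hi] using h i⟩
  simp only [key]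
  obtain ⟨u, hu⟩ := LinearMap.injective_iff_surjective.1 hinj fun i => if S i then b i else 0
  exact ⟨u, hu, fun w hw => hinj (hw.trans hu.symm)⟩

namespace Mesh

variable {d : ℕ} (T : Mesh d)

theorem hat_nonneg (v x : Pt d) : 0 ≤ T.hat v x := by
  by_cases h : ∃ K ∈ T.elements, x ∈ convexHull ℝ (K : Set (Pt d))
  · obtain ⟨K, hK, hx⟩ := h
    rw [T.hat_eq hK v hx, baryCoord]
    split_ifs with hv
    · exact (T.mem_convexHull_iff hK).1 hx _
    · exact le_rfl
  · rw [hat, dif_neg h]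

/-- The transfer matrix is injective, with a quantitative bound. -/
theorem dotProduct_self_le (hd : 1 ≤ d) {R : ℝ} (hR : 0 < R) {N : ℕ} (hN : 1 ≤ N)
    (hT : ∀ x ∈ T.space, ∀ i, x i ∈ Set.Ioo (-R) R)
    (hh : spacing R N ≤ T.minHeight / ((d + 1) * Real.sqrt d)) (u : T.nodes → ℝ) :
    u ⬝ᵥ u ≤ ((1 + 4 * d * ((d + 1) * Real.sqrt d)) * (T.maxDiam / T.minHeight)) ^ 2 *
      ((d + 1) * T.valence * ((T.transfer R N *ᵥ u) ⬝ᵥ (T.transfer R N *ᵥ u))) := by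
  classical
  set G := ((1 + 4 * d * ((d + 1) * Real.sqrt d)) * (T.maxDiam / T.minHeight)) ^ 2
  have hG : 0 ≤ G := sq_nonneg _
  set y := T.transfer R N *ᵥ u with hy
  -- The grid energy on `K`, which dominates each single square. Double counting then uses that an
  -- element has `d + 1` vertices and a grid node lies in at most `N_val` elements.
  set e : Finset (Pt d) → ℝ := fun K =>
    ∑ k, if gridPt R k ∈ convexHull ℝ (K : Set (Pt d)) then y k ^ 2 else 0 with he
  have he0 : ∀ K, 0 ≤ e K := fun K =>
    Finset.sum_nonneg fun k _ => by split_ifs <;> positivity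
  have h1 : ∀ v : T.nodes, u v ^ 2 ≤
      G * ∑ K ∈ T.elements, if (v : Pt d) ∈ K then e K else 0 := by
    intro v
    obtain ⟨K, hK, hv⟩ := mem_nodes.1 v.2
    refine (T.sq_apply_le_sum_grid hd hR hN hT hh u hK ⟨v, hv⟩ (B := e K) fun k hk => ?_).trans ?_
    · have := Finset.single_le_sum (f := fun k : GridIdx d N =>
        if gridPt R k ∈ convexHull ℝ (K : Set (Pt d)) then y k ^ 2 else 0)
        (fun k _ => by split_ifs <;> positivity) (Finset.mem_univ k)
      simpa [hk] using this
    · refine mul_le_mul_of_nonneg_left ?_ hG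
      have := Finset.single_le_sum (f := fun K : Finset (Pt d) => if (v : Pt d) ∈ K then e K else 0)
        (fun K _ => by split_ifs <;> simp [he0]) hK
      simpa [hv] using this
  have h2 : ∀ K ∈ T.elements,
      (∑ v : T.nodes, if (v : Pt d) ∈ K then e K else 0) ≤ (d + 1) * e K := by
    intro K hK
    rw [Finset.sum_coe_sort T.nodes fun v => if v ∈ K then e K else 0, ← Finset.sum_filter,
      Finset.sum_const, nsmul_eq_mul]
    refine mul_le_mul_of_nonneg_right ?_ (he0 K)
    have : (T.nodes.filter fun v => v ∈ K).card ≤ d + 1 := by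
      rw [← (mem_elements.1 hK).2]
      exact Finset.card_le_card fun v hv => (Finset.mem_filter.1 hv).2
    exact_mod_cast this
  have h3 : ∑ K ∈ T.elements, e K ≤ T.valence * (y ⬝ᵥ y) := by
    rw [he, Finset.sum_comm, dotProduct, Finset.mul_sum]
    refine Finset.sum_le_sum fun k _ => ?_
    rw [← Finset.sum_filter, Finset.sum_const, nsmul_eq_mul, ← sq]
    refine mul_le_mul_of_nonneg_right ?_ (sq_nonneg _)
    have := T.card_elements_containing_le (gridPt R k)
    convert (Nat.cast_le (α := ℝ)).2 this
  calc u ⬝ᵥ u = ∑ v : T.nodes, u v ^ 2 := Finset.sum_congr rfl fun v _ => (sq _).symm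
    _ ≤ ∑ v : T.nodes, G * ∑ K ∈ T.elements, if (v : Pt d) ∈ K then e K else 0 :=
      Finset.sum_le_sum fun v _ => h1 v
    _ = G * ∑ K ∈ T.elements, ∑ v : T.nodes, if (v : Pt d) ∈ K then e K else 0 := by
      rw [← Finset.mul_sum, Finset.sum_comm]
    _ ≤ G * ∑ K ∈ T.elements, (d + 1) * e K :=
      mul_le_mul_of_nonneg_left (Finset.sum_le_sum h2) hG
    _ ≤ G * ((d + 1) * (T.valence * (y ⬝ᵥ y))) := by
      rw [← Finset.mul_sum]
      gcongr
    _ = _ := by ring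

theorem one_le_maxGridNodes (hd : 1 ≤ d) {R : ℝ} (hR : 0 < R) {N : ℕ} (hN : 1 ≤ N)
    (hT : ∀ x ∈ T.space, ∀ i, x i ∈ Set.Ioo (-R) R)
    (hh : spacing R N ≤ T.minHeight / ((d + 1) * Real.sqrt d)) : 1 ≤ T.maxGridNodes R N := by
  classical
  obtain ⟨K, hK⟩ := T.elements_nonempty
  obtain ⟨k, -, -, hk, -⟩ := T.exists_grid_corner hd hR hN hT hh hK
  unfold maxGridNodes
  refine le_trans ?_ (Finset.le_sup hK)
  exact Finset.card_pos.2 ⟨k, Finset.mem_filter.2 ⟨Finset.mem_univ k, hk⟩⟩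

/-- Invertibility of `D_h`: the entries are nonnegative, so a vanishing column sum would put a unit
vector in the kernel of the injective transfer matrix. -/
theorem sum_transfer_pos (hd : 1 ≤ d) {R : ℝ} (hR : 0 < R) {N : ℕ} (hN : 1 ≤ N)
    (hT : ∀ x ∈ T.space, ∀ i, x i ∈ Set.Ioo (-R) R)
    (hh : spacing R N ≤ T.minHeight / ((d + 1) * Real.sqrt d)) (v : T.nodes) :
    0 < ∑ k, T.transfer R N k v := by
  classical
  refine (Finset.sum_nonneg fun k _ => T.hat_nonneg _ _).lt_of_ne' fun h => ?_
  have h1 : T.transfer R N *ᵥ Pi.single v 1 = 0 := by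
    rw [mulVec_single_one]
    ext k
    exact (Finset.sum_eq_zero_iff_of_nonneg fun k _ => T.hat_nonneg _ _).1 h k (Finset.mem_univ k)
  have h2 := T.dotProduct_self_le hd hR hN hT hh (Pi.single v 1)
  rw [h1] at h2
  norm_num at h2

/-- The residual after multiplication by `D_h`. -/
theorem residual_eq_zero_iff (hd : 1 ≤ d) {R : ℝ} (hR : 0 < R) {N : ℕ} (hN : 1 ≤ N)
    (hT : ∀ x ∈ T.space, ∀ i, x i ∈ Set.Ioo (-R) R)
    (hh : spacing R N ≤ T.minHeight / ((d + 1) * Real.sqrt d)) (s : ℝ) (F : GridIdx d N → ℝ)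
    (u : T.nodes → ℝ) (v : T.nodes) :
    T.residual s R N F u v = 0 ↔
      (((1 / spacing R N ^ (2 * s)) •
        ((T.transfer R N)ᵀ * gridMatrix d s N * T.transfer R N)) *ᵥ u) v =
      ((T.transfer R N)ᵀ *ᵥ F) v := by
  classical
  have hpos := T.sum_transfer_pos hd hR hN hT hh
  have hdet : IsUnit (T.colSum R N).det := by
    rw [colSum, det_diagonal, isUnit_iff_ne_zero]
    exact Finset.prod_ne_zero_iff.2 fun v _ => (hpos v).ne'
  have h1 : T.colSum R N *ᵥ T.residual s R N F u =
      (1 / spacing R N ^ (2 * s)) •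
        (((T.transfer R N)ᵀ * gridMatrix d s N * T.transfer R N) *ᵥ u) -
      (T.transfer R N)ᵀ *ᵥ F := by
    rw [residual, stiffness, mulVec_sub, mulVec_smul, mulVec_mulVec, mulVec_mulVec]
    simp only [Matrix.mul_assoc]
    rw [mul_nonsing_inv_cancel_left _ _ hdet, mul_nonsing_inv_cancel_left _ _ hdet]
  -- `D_h` is diagonal, so it can be cleared from each equation separately, as the Dirichlet reading
  -- requires.
  have h2 := congrFun h1 v
  rw [colSum, mulVec_diagonal, Pi.sub_apply] at h2
  rw [smul_mulVec, ← sub_eq_zero (b := ((T.transfer R N)ᵀ *ᵥ F) v), ← h2, mul_eq_zero,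
    or_iff_right (hpos v).ne']

end Mesh

/-! ### Scaled coercivity, solvability and the energy estimate -/

/-- The lower bound for the smallest eigenvalue of the scaled matrix `h_FD^{-2s} A_FD`. -/
theorem scaled_gridMatrix_coercive {d N : ℕ} (hd : 1 ≤ d) (hN : 1 ≤ N) {s : ℝ} (hs : 0 ≤ s)
    {R : ℝ} (hR : 0 < R) (y : GridIdx d N → ℝ) :
    1 / 2 * (1 / (9 * R ^ 2)) ^ s * (y ⬝ᵥ y) ≤
      1 / spacing R N ^ (2 * s) * (y ⬝ᵥ (gridMatrix d s N *ᵥ y)) := by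
  have hN' : (0 : ℝ) < N := by exact_mod_cast hN
  have hη : 0 < spacing R N := div_pos hR hN'
  have h1 : 1 / spacing R N ^ (2 * s) = (1 / spacing R N ^ 2) ^ s := by
    rw [Real.rpow_mul hη.le, Real.rpow_two, Real.div_rpow zero_le_one (sq_nonneg _), Real.one_rpow]
  -- `N` cancels because `N h_FD = R`.
  have h2 : (1 / (9 * R ^ 2)) ^ s = 1 / spacing R N ^ (2 * s) * (1 / (9 * (N : ℝ) ^ 2)) ^ s := by
    rw [h1, ← Real.mul_rpow (by positivity) (by positivity)]
    congr 1
    unfold spacing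
    field_simp
  rw [h2]
  calc _ = 1 / spacing R N ^ (2 * s) * (1 / 2 * (1 / (9 * (N : ℝ) ^ 2)) ^ s * (y ⬝ᵥ y)) := by ring
    _ ≤ _ := by
      refine mul_le_mul_of_nonneg_left (gridMatrix_coercive hd hN hs y) ?_
      have := Real.rpow_nonneg hη.le (2 * s)
      positivity

namespace Mesh

variable {d : ℕ} (T : Mesh d)

theorem dotProduct_energy (s R : ℝ) (N : ℕ) (c : ℝ) (u : T.nodes → ℝ) :
    u ⬝ᵥ ((c • ((T.transfer R N)ᵀ * gridMatrix d s N * T.transfer R N)) *ᵥ u) =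
      c * ((T.transfer R N *ᵥ u) ⬝ᵥ (gridMatrix d s N *ᵥ (T.transfer R N *ᵥ u))) := by
  rw [smul_mulVec, dotProduct_smul, smul_eq_mul, Matrix.mul_assoc, ← mulVec_mulVec,
    ← mulVec_mulVec, dotProduct_mulVec, vecMul_transpose]

theorem existsUnique_residual (hd : 1 ≤ d) {s : ℝ} (hs : 0 ≤ s) {R : ℝ} (hR : 0 < R) {N : ℕ}
    (hN : 1 ≤ N) (hT : ∀ x ∈ T.space, ∀ i, x i ∈ Set.Ioo (-R) R)
    (hh : spacing R N ≤ T.minHeight / ((d + 1) * Real.sqrt d)) (Ω : Set (Pt d))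
    (F : GridIdx d N → ℝ) : ∃! u : T.nodes → ℝ, T.IsDirichletSolution Ω s R N F u := by
  simp only [IsDirichletSolution, T.residual_eq_zero_iff hd hR hN hT hh]
  refine existsUnique_constrained _ (fun u hu => ?_) (fun v : T.nodes => (v : Pt d) ∈ Ω) _
  rw [T.dotProduct_energy] at hu
  have h1 := scaled_gridMatrix_coercive hd hN hs hR (T.transfer R N *ᵥ u)
  rw [hu] at h1
  have h2 := T.dotProduct_self_le hd hR hN hT hh u
  have h3 : 0 < 1 / 2 * (1 / (9 * R ^ 2)) ^ s := by positivity
  have h4 : (T.transfer R N *ᵥ u) ⬝ᵥ (T.transfer R N *ᵥ u) = 0 :=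
    le_antisymm (nonpos_of_mul_nonpos_right h1 h3)
      (Finset.sum_nonneg fun i _ => mul_self_nonneg _)
  rw [h4, mul_zero, mul_zero] at h2
  exact dotProduct_self_eq_zero.1
    (le_antisymm h2 (Finset.sum_nonneg fun i _ => mul_self_nonneg _))

/-- The stability estimate on the uniform grid. -/
theorem transfer_mulVec_dotProduct_self_le (hd : 1 ≤ d) {s : ℝ} (hs : 0 ≤ s) {R : ℝ} (hR : 0 < R)
    {N : ℕ} (hN : 1 ≤ N) (hT : ∀ x ∈ T.space, ∀ i, x i ∈ Set.Ioo (-R) R)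
    (hh : spacing R N ≤ T.minHeight / ((d + 1) * Real.sqrt d)) {Ω : Set (Pt d)}
    {F : GridIdx d N → ℝ} {u : T.nodes → ℝ} (hu : T.IsDirichletSolution Ω s R N F u) :
    (1 / 2 * (1 / (9 * R ^ 2)) ^ s) ^ 2 * ((T.transfer R N *ᵥ u) ⬝ᵥ (T.transfer R N *ᵥ u)) ≤
      F ⬝ᵥ F := by
  obtain ⟨h0, h1⟩ := hu
  simp only [T.residual_eq_zero_iff hd hR hN hT hh] at h1
  -- Testing with `u`: the equations that need not hold are multiplied by `u v = 0`.
  have h2 : u ⬝ᵥ (((1 / spacing R N ^ (2 * s)) •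
      ((T.transfer R N)ᵀ * gridMatrix d s N * T.transfer R N)) *ᵥ u) =
      u ⬝ᵥ ((T.transfer R N)ᵀ *ᵥ F) := by
    refine Finset.sum_congr rfl fun v _ => ?_
    by_cases hv : (v : Pt d) ∈ Ω
    · rw [h1 v hv]
    · rw [h0 v hv, zero_mul, zero_mul]
  rw [T.dotProduct_energy, dotProduct_mulVec u, vecMul_transpose] at h2
  have h3 := scaled_gridMatrix_coercive hd hN hs hR (T.transfer R N *ᵥ u)
  rw [h2] at h3
  set c := 1 / 2 * (1 / (9 * R ^ 2)) ^ s
  set y := T.transfer R N *ᵥ u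
  -- This square gives `2c y·F ≤ F·F + c² y·y`, while coercivity gives `2c² y·y ≤ 2c y·F`.
  have h4 : 0 ≤ (F - c • y) ⬝ᵥ (F - c • y) := Finset.sum_nonneg fun i _ => mul_self_nonneg _
  have hc : 0 < c := by positivity
  simp only [dotProduct_sub, sub_dotProduct, dotProduct_smul, smul_dotProduct, smul_eq_mul] at h4
  rw [dotProduct_comm F y] at h4
  have h5 := mul_le_mul_of_nonneg_left h3 hc.le
  linarith [h4, h5]

theorem isDirichletSolution_univ (s R : ℝ) (N : ℕ) (F : GridIdx d N → ℝ) (u : T.nodes → ℝ) :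
    T.IsDirichletSolution Set.univ s R N F u ↔ T.IsSolution s R N F u := by
  simp [IsDirichletSolution, IsSolution, funext_iff]

end Mesh

end GoFD

theorem mainTheorem3 (d : ℕ) (hd : 1 ≤ d) (s : ℝ) (hs : s ∈ Set.Ioo (0 : ℝ) 1)
    (R : ℝ) (hR : 0 < R) :
    ∃ C : ℝ, 0 < C ∧
      ∀ (N : ℕ), 1 ≤ N →
      ∀ (T : GoFD.Mesh d), (∀ x ∈ T.space, ∀ i, x i ∈ Set.Ioo (-R) R) →
      GoFD.spacing R N ≤ T.minHeight / ((d + 1) * Real.sqrt d) →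
      ∀ (Ω : Set (GoFD.Pt d)) (f : GoFD.Pt d → ℝ),
        (∃! u : T.nodes → ℝ, T.IsSolution s R N (GoFD.gridVec Ω f R N) u) ∧
        (∃! u : T.nodes → ℝ, T.IsDirichletSolution Ω s R N (GoFD.gridVec Ω f R N) u) ∧
        ∀ u : T.nodes → ℝ,
          (T.IsSolution s R N (GoFD.gridVec Ω f R N) u ∨
            T.IsDirichletSolution Ω s R N (GoFD.gridVec Ω f R N) u) →
          u ⬝ᵥ u ≤ C * T.valence * T.maxGridNodes R N * (T.maxDiam / T.minHeight) ^ (4 * d) *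
            (GoFD.gridVec Ω f R N ⬝ᵥ GoFD.gridVec Ω f R N) := by
  set G : ℝ := 1 + 4 * d * ((d + 1) * Real.sqrt d) with hG
  set c : ℝ := 1 / 2 * (1 / (9 * R ^ 2)) ^ s with hc_def
  have hc : 0 < c := by positivity
  have hs0 : 0 ≤ s := hs.1.le
  refine ⟨G ^ 2 * (d + 1) / c ^ 2, by positivity, fun N hN T hT hh Ω f => ?_⟩
  set F := GoFD.gridVec Ω f R N with hF
  have hF0 : 0 ≤ F ⬝ᵥ F := Finset.sum_nonneg fun i _ => mul_self_nonneg _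
  refine ⟨?_, T.existsUnique_residual hd hs0 hR hN hT hh Ω F, fun u hu => ?_⟩
  -- The full system is the constrained one with no constraint; `F` is still built from the given
  -- `Ω`.
  · simpa only [T.isDirichletSolution_univ] using
      T.existsUnique_residual hd hs0 hR hN hT hh Set.univ F
  have hy : c ^ 2 * ((T.transfer R N).mulVec u ⬝ᵥ (T.transfer R N).mulVec u) ≤ F ⬝ᵥ F := by
    rcases hu with hu | hu
    · exact T.transfer_mulVec_dotProduct_self_le hd hs0 hR hN hT hh
        ((T.isDirichletSolution_univ s R N F u).2 hu)
    · exact T.transfer_mulVec_dotProduct_self_le hd hs0 hR hN hT hh hu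
  have hu' := T.dotProduct_self_le hd hR hN hT hh u
  rw [← hG] at hu'
  have hnodes : (1 : ℝ) ≤ T.maxGridNodes R N := by
    exact_mod_cast T.one_le_maxGridNodes hd hR hN hT hh
  have ha : 0 < T.minHeight := by
    have hη : 0 < GoFD.spacing R N := div_pos hR (by exact_mod_cast hN)
    have hD : 0 < (d + 1) * Real.sqrt d := by
      have : (0 : ℝ) < d := by exact_mod_cast hd
      positivity
    exact (div_pos_iff_of_pos_right hD).1 (hη.trans_le hh)
  set q := T.maxDiam / T.minHeight with hq_def
  have hq : 1 ≤ q := (one_le_div ha).2 (T.minHeight_le_maxDiam hd)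
  -- The argument yields exponent `2`; `q ≥ 1` and `hnodes` weaken the bound to the stated form.
  have hq' : q ^ 2 ≤ q ^ (4 * d) := pow_le_pow_right₀ hq (by omega)
  rw [mul_comm (c ^ 2), ← le_div_iff₀ (by positivity)] at hy
  calc u ⬝ᵥ u ≤ (G * q) ^ 2 * ((d + 1) * T.valence *
        ((T.transfer R N).mulVec u ⬝ᵥ (T.transfer R N).mulVec u)) := hu'
    _ ≤ (G * q) ^ 2 * ((d + 1) * T.valence * (F ⬝ᵥ F / c ^ 2)) := by gcongr
    _ = G ^ 2 * (d + 1) / c ^ 2 * T.valence * 1 * q ^ 2 * (F ⬝ᵥ F) := by ring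
    _ ≤ _ := by gcongr
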